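/- All graphs are finite, simple and undirected. For a graph $G$ with vertices $v_1,\dots,v_n$ and edges $e_1,\dots,e_m$, and graphs $H_1$ on $u_1,\dots,u_n$ and $H_2$ on $w_1,\dots,w_m$, let $[S(G)]^{H_1}_{H_2}$ be the graph obtained from the subdivision graph $S(G)$ (a new vertex is inserted into every edge of $G$) by joining $v_i$ and $v_j$ whenever $u_i,u_j$ are adjacent in $H_1$, and joining the new vertices lying on $e_s$ and $e_t$ whenever $w_s,w_t$ are adjacent in $H_2$. Put $[S(G)]^{H}=[S(G)]^{H}_{\overline{K_m}}$ and $[S(G)]_{H}=[S(G)]^{\overline{K_n}}_{H}$. Let $\tau$ denote the number of spanning trees, $\mathcal L(G)$ the line graph of $G$, and let the $\mu_i$ be Laplacian eigenvalues, listed with multiplicity. Two graphs on the same labelled vertex set commute if their adjacency matrices commute. Let $n\ge 1$, let $G$ be an $r$-regular graph with $n$ vertices and $m$ edges, and let $H$ be a graph on the same vertex set which commutes with $G$. Then the Laplacian matrices of $G$ and $H$ have a common orthonormal eigenbasis $x_1,\dots,x_n$ such that the corresponding eigenvalues $\mu_i(G)$ and $\mu_i(H)$ (both belonging to $x_i$)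 satisfy $\mu_1(G)=\mu_1(H)=0$, and for every such listing of the eigenvalues: 1. $\displaystyle \tau\big([S(G)]^{H}\big)=2^{m-n+1}\cdot\frac1n\prod_{i=2}^{n}\big(2\mu_i(H)+\mu_i(G)\big)$; 2. $\displaystyle \tau\big([S(G)]^{H}_{K_m}\big)=(m+2)^{m-n}\cdot\frac2n\prod_{i=2}^{n}\big((m+2)(r+\mu_i(H))+\mu_i(G)-2r\big)$; 3. $\displaystyle \tau\big([S(G)]^{H}_{\overline{\mathcal L(G)}}\big)=(m-2r+2)^{m-n}\cdot\frac2n\prod_{i=2}^{n}\big((r+\mu_i(H))(m-\mu_i(G)+2)+\mu_i(G)-2r\big)$. Moreover: 4. if $m\ge 1$ and $H$ is any graph with $m$ vertices, with Laplacian eigenvalues $\mu_1(H)=0,\mu_2(H),\dots,\mu_m(H)$ corresponding to an orthonormal eigenbasis, then, for every labelling of the vertices of $H$ by the edges of the star $K_{1,m}$, $\displaystyle \tau\big([S(K_{1,m})]_{H}\big)=\prod_{i=2}^{m}\big(\mu_i(H)+1\big)$. -/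

import Mathlib

open scoped Matrix

/-- The `(H₁, H₂)`-merged subdivision graph `[S(G)]^{H₁}_{H₂}` of `G`. Its vertices are the vertices
of `G` together with one new vertex for each edge of `G`. A vertex `v` of `G` is adjacent to the new
vertex of an edge `e` iff `v` is an end of `e` (this is the subdivision graph `S(G)`), the vertices
of `G` are joined as in `H₁`, and the new vertices are joined as in `H₂`. The graphs `H₁` and `H₂`
are labelled by the vertices and by the edges of `G`, respectively. -/
def mergedSubdivision {V : Type*} (G : SimpleGraph V) (H₁ : SimpleGraph V)
    (H₂ : SimpleGraph G.edgeSet) : SimpleGraph (V ⊕ G.edgeSet) where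
  Adj
    | .inl u, .inl v => H₁.Adj u v
    | .inl u, .inr e => u ∈ (e : Sym2 V)
    | .inr e, .inl u => u ∈ (e : Sym2 V)
    | .inr e, .inr f => H₂.Adj e f
  symm := ⟨by
    rintro (u | e) (v | f) h
    · exact h.symm
    · exact h
    · exact h
    · exact h.symm⟩
  loopless := ⟨by
    rintro (u | e) h
    · exact h.ne rfl
    · exact h.ne rfl⟩

/-- `τ(G)`: the number of spanning trees of `G`, that is, of the trees on the whole vertex set of
`G` all of whose edges are edges of `G`. -/
noncomputable def numSpanningTrees {V : Type*} (G : SimpleGraph V) : ℕ :=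
  {T : SimpleGraph V | T ≤ G ∧ T.IsTree}.ncard

/-- Two graphs on the same vertex set commute if their adjacency matrices commute. -/
def CommutingGraphs {V : Type*} [Fintype V] [DecidableEq V] (G H : SimpleGraph V)
    [DecidableRel G.Adj] [DecidableRel H.Adj] : Prop :=
  G.adjMatrix ℝ * H.adjMatrix ℝ = H.adjMatrix ℝ * G.adjMatrix ℝ

/-- `x` is an eigenbasis of the Laplacian matrix of `G`, and `μ i` is the eigenvalue of `x i`. -/
def IsLaplacianEigenbasis {V : Type*} [Fintype V] [DecidableEq V] (G : SimpleGraph V)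
    [DecidableRel G.Adj] {n : ℕ} (x : OrthonormalBasis (Fin n) ℝ (EuclideanSpace ℝ V))
    (μ : Fin n → ℝ) : Prop :=
  ∀ i, G.lapMatrix ℝ *ᵥ (x i).ofLp = μ i • (x i).ofLp

/-- `μ` lists the Laplacian eigenvalues of `G` with multiplicity, and the first one is `0`. The
indices `1, …, n` of the usual notation are written `0, …, n - 1`. -/
def IsLaplacianSpectrum {V : Type*} [Fintype V] [DecidableEq V] (G : SimpleGraph V)
    [DecidableRel G.Adj] {n : ℕ} [NeZero n] (μ : Fin n → ℝ) : Prop :=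
  (∃ x : OrthonormalBasis (Fin n) ℝ (EuclideanSpace ℝ V), IsLaplacianEigenbasis G x μ) ∧ μ 0 = 0

/-- `μG` and `μH` list the Laplacian eigenvalues of `G` and of `H` with multiplicity in such a way
that `μG i` and `μH i` belong to the same eigenvector `x i`, for a common orthonormal eigenbasis
`x`, and that the first eigenvalue of each is `0`. -/
def IsJointLaplacianSpectrum {V : Type*} [Fintype V] [DecidableEq V] (G H : SimpleGraph V)
    [DecidableRel G.Adj] [DecidableRel H.Adj] {n : ℕ} [NeZero n] (μG μH : Fin n → ℝ) : Prop :=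
  (∃ x : OrthonormalBasis (Fin n) ℝ (EuclideanSpace ℝ V),
    IsLaplacianEigenbasis G x μG ∧ IsLaplacianEigenbasis H x μH) ∧ μG 0 = 0 ∧ μH 0 = 0

/-! By the matrix tree theorem every entry of the adjugate of a Laplacian `L` is `τ`, so the matrix
determinant lemma gives `det (L + u uᵀ) = (∑ u)² τ` (`SimpleGraph.det_lapMatrix_add_vecMulVec`).
With `B` the incidence matrix, the Laplacian of the merged graph has diagonal blocks `D + L(H₁)`,
`2I + L(H₂)` and off-diagonal blocks `-B`, `-Bᵀ`.

For regular `G`, all three choices of `H₂` give `2I + L(H₂) = cI + Bᵀ K B` with `K = aI - bJ`, since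
`BᵀJB = 4J` and `BᵀB = 2I + A(ℒ(G))`. Eliminating the edge block
(`Matrix.pow_mul_det_fromBlocks_gram`) leaves an `n × n` determinant in which `B` occurs only
through `BBᵀ = 2rI - L(G)`. Up to a multiple of `J` its matrix is a polynomial in `L(G)` and `L(H)`,
so a common eigenbasis and `Matrix.det_add_smul_ones` evaluate it.

For the star the vertex block is eliminated instead: it is the identity plus a rank-one term at the
centre, and the Schur complement is `L(H) + I` plus a multiple of `J`. -/

/-! ### Rooted trees as parent functions -/

/-- `f` is the parent function of a tree on `V` rooted at `ρ`. -/
def IsParentFunction {V : Type*} (ρ : V) (f : V → V) : Prop :=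
  f ρ = ρ ∧ ∀ v, ∃ k, f^[k] v = ρ

/-- The graph in which every vertex is joined to its image under `f`. -/
def functionGraph {V : Type*} (f : V → V) : SimpleGraph V :=
  SimpleGraph.fromRel fun v w => f v = w

namespace IsParentFunction

variable {V : Type*} {ρ : V} {f g : V → V}

theorem exists_depth (hf : IsParentFunction ρ f) :
    ∃ d : V → ℕ, ∀ v, v ≠ ρ → d (f v) < d v := by
  classical
  refine ⟨fun v => Nat.find (hf.2 v), fun v hv => ?_⟩
  have h := Nat.find_spec (hf.2 v)
  rcases hk : Nat.find (hf.2 v) with _ | k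
  · rw [hk] at h
    exact absurd h hv
  · rw [hk, Function.iterate_succ_apply] at h
    have := Nat.find_min' (hf.2 (f v)) h
    show Nat.find (hf.2 (f v)) < Nat.find (hf.2 v)
    omega

theorem of_depth (d : V → ℕ) (hρ : f ρ = ρ) (hd : ∀ v, v ≠ ρ → d (f v) < d v) :
    IsParentFunction ρ f := by
  refine ⟨hρ, fun v => ?_⟩
  induction h : d v using Nat.strong_induction_on generalizing v with
  | _ n ih =>
    by_cases hv : v = ρ
    · exact ⟨0, hv⟩
    · obtain ⟨k, hk⟩ := ih _ (h ▸ hd v hv) (f v) rfl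
      exact ⟨k + 1, by rwa [Function.iterate_succ_apply]⟩

theorem ne_of_ne (hf : IsParentFunction ρ f) {v : V} (hv : v ≠ ρ) : f v ≠ v := by
  obtain ⟨d, hd⟩ := hf.exists_depth
  intro h
  have := hd v hv
  rw [h] at this
  omega

theorem connected (hf : IsParentFunction ρ f) : (functionGraph f).Connected := by
  have key : ∀ v, (functionGraph f).Reachable v ρ := by
    obtain ⟨d, hd⟩ := hf.exists_depth
    intro v
    induction h : d v using Nat.strong_induction_on generalizing v with
    | _ n ih =>
      by_cases hv : v = ρ
      · rw [hv]
      · refine SimpleGraph.Reachable.trans (SimpleGraph.Adj.reachable ?_)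
          (ih _ (h ▸ hd v hv) (f v) rfl)
        exact ⟨(hf.ne_of_ne hv).symm, Or.inl rfl⟩
  have : Nonempty V := ⟨ρ⟩
  exact ⟨fun v w => (key v).trans (key w).symm⟩

theorem isTree [Finite V] (hf : IsParentFunction ρ f) : (functionGraph f).IsTree := by
  classical
  cases nonempty_fintype V
  have hc := hf.connected
  refine SimpleGraph.isTree_iff_connected_and_card.2 ⟨hc, le_antisymm ?_
    hc.card_vert_le_card_edgeSet_add_one⟩
  have hsub : (functionGraph f).edgeSet ⊆
      ((Finset.univ.erase ρ).image fun v => s(v, f v) : Finset (Sym2 V)) := by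
    intro e
    induction e with
    | _ v w =>
      rintro ⟨hne, h | h⟩
      · simp only [Finset.coe_image, Set.mem_image]
        refine ⟨v, ?_, by rw [h]⟩
        simp only [Finset.coe_erase, Set.mem_sdiff, Set.mem_singleton_iff, Finset.coe_univ,
          Set.mem_univ, true_and]
        rintro rfl
        exact hne (hf.1 ▸ h)
      · simp only [Finset.coe_image, Set.mem_image]
        refine ⟨w, ?_, by rw [h, Sym2.eq_swap]⟩
        simp only [Finset.coe_erase, Set.mem_sdiff, Set.mem_singleton_iff, Finset.coe_univ,
          Set.mem_univ, true_and]
        rintro rfl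
        exact hne (hf.1 ▸ h).symm
  have h1 := Nat.card_mono (Finset.finite_toSet _) hsub
  have h2 : ((Finset.univ.erase ρ).image fun v => s(v, f v)).card ≤ Fintype.card V - 1 := by
    refine Finset.card_image_le.trans ?_
    simp
  have h3 : 0 < Fintype.card V := Fintype.card_pos_iff.2 ⟨ρ⟩
  rw [Nat.card_coe_set_eq, Nat.card_coe_set_eq, Set.ncard_coe_finset] at h1
  rw [Nat.card_coe_set_eq, Nat.card_eq_fintype_card]
  omega

/-- A disagreement at `v` forces `g (f v) = v`, because the edge from `v` to `f v` must also come
from `g`. Agreement at `f v` would then make `v` and `f v` a 2-cycle of `f`, which depth forbids. So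
disagreement climbs the `f`-path up to `ρ`, where both functions fix `ρ`. -/
theorem eq_of_functionGraph_eq (hf : IsParentFunction ρ f) (hg : IsParentFunction ρ g)
    (h : functionGraph f = functionGraph g) : f = g := by
  obtain ⟨d, hd⟩ := hf.exists_depth
  have step : ∀ v, f v ≠ g v → v ≠ ρ ∧ f (f v) ≠ g (f v) := by
    intro v hv
    have hvρ : v ≠ ρ := by
      rintro rfl
      exact hv (hf.1.trans hg.1.symm)
    have hadj : (functionGraph f).Adj v (f v) := ⟨(hf.ne_of_ne hvρ).symm, Or.inl rfl⟩
    rw [h] at hadj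
    have hgf : g (f v) = v := hadj.2.resolve_left fun h => hv h.symm
    refine ⟨hvρ, fun h' => ?_⟩
    rw [hgf] at h'
    have hfρ : f v ≠ ρ := by
      intro h0
      rw [h0, hf.1] at h'
      exact hvρ h'.symm
    have h1 := hd v hvρ
    have h2 := hd (f v) hfρ
    rw [h'] at h2
    omega
  have key : ∀ v, f v = g v := by
    intro v
    by_contra hv
    obtain ⟨k, hk⟩ := hf.2 v
    have : ∀ k, f (f^[k] v) ≠ g (f^[k] v) := by
      intro k
      induction k with
      | zero => exact hv
      | succ k ih =>
        rw [Function.iterate_succ_apply']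
        exact (step _ ih).2
    exact (step _ (this k)).1 hk
  exact funext key

end IsParentFunction

/-- The parent of `v` is the next vertex on a shortest walk to `ρ`. The resulting graph is a
connected subgraph of `T`, and a tree is minimal among connected graphs. -/
theorem SimpleGraph.IsTree.exists_parentFunction {V : Type*} [Finite V] {T : SimpleGraph V}
    (hT : T.IsTree) (ρ : V) :
    ∃ f : V → V, IsParentFunction ρ f ∧ (∀ v, v ≠ ρ → T.Adj v (f v)) ∧ functionGraph f = T := by
  classical
  have hex : ∀ v, ∃ w, (v = ρ → w = ρ) ∧ (v ≠ ρ → T.Adj v w ∧ T.dist w ρ < T.dist v ρ) := by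
    intro v
    by_cases hv : v = ρ
    · exact ⟨ρ, fun _ => rfl, fun h => absurd hv h⟩
    · obtain ⟨p, hp⟩ := hT.connected.exists_walk_length_eq_dist v ρ
      cases p with
      | nil => exact absurd rfl hv
      | cons hadj q =>
        refine ⟨_, fun h => absurd h hv, fun _ => ⟨hadj, ?_⟩⟩
        have := SimpleGraph.dist_le q
        rw [SimpleGraph.Walk.length_cons] at hp
        omega
  choose f hf1 hf2 using hex
  have hf : IsParentFunction ρ f :=
    .of_depth (fun v => T.dist v ρ) (hf1 ρ rfl) fun v hv => (hf2 v hv).2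
  refine ⟨f, hf, fun v hv => (hf2 v hv).1, ?_⟩
  have hle : functionGraph f ≤ T := by
    rintro v w ⟨hne, h | h⟩
    · have hv : v ≠ ρ := by
        rintro rfl
        exact hne (hf.1 ▸ h)
      exact h ▸ (hf2 v hv).1
    · have hw : w ≠ ρ := by
        rintro rfl
        exact hne (hf.1 ▸ h).symm
      exact h ▸ (hf2 w hw).1.symm
  exact le_antisymm hle ((SimpleGraph.isTree_iff_minimal_connected.1 hT).2 hf.connected hle)

/-! ### The matrix tree theorem -/

section MatrixTree

variable {V : Type*} [Fintype V] [DecidableEq V]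

/-- Row `v` is `e_v - e_{f v}`, except that row `ρ` is `e_ρ`. -/
def parentMatrix (ρ : V) (f : V → V) : Matrix V V ℝ :=
  Matrix.of fun v => if v = ρ then Pi.single ρ 1 else Pi.single v 1 - Pi.single (f v) 1

/-- Parents have strictly smaller depth, so ordering by depth makes the matrix block triangular with
identity diagonal blocks. -/
theorem det_parentMatrix_of_isParentFunction {ρ : V} {f : V → V} (hf : IsParentFunction ρ f) :
    (parentMatrix ρ f).det = 1 := by
  obtain ⟨d, hd⟩ := hf.exists_depth
  have hM : ∀ v w, d v ≤ d w → parentMatrix ρ f v w = (1 : Matrix V V ℝ) v w := by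
    intro v w hvw
    by_cases hv : v = ρ
    · simp [parentMatrix, hv, Matrix.one_apply, Pi.single_apply, eq_comm]
    · have hw : w ≠ f v := by
        rintro rfl
        exact absurd (hd v hv) (not_lt.2 hvw)
      simp [parentMatrix, hv, Matrix.one_apply, Pi.single_apply, eq_comm (a := w), hw.symm]
  have hbt : (parentMatrix ρ f)ᵀ.BlockTriangular d := by
    intro v w hvw
    rw [Matrix.transpose_apply, hM _ _ hvw.le, Matrix.one_apply_ne]
    rintro rfl
    exact lt_irrefl _ hvw
  rw [← Matrix.det_transpose, hbt.det]
  refine Finset.prod_eq_one fun a _ => ?_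
  have : (parentMatrix ρ f)ᵀ.toSquareBlock d a = 1 := by
    ext ⟨v, hv⟩ ⟨w, hw⟩
    rw [Matrix.toSquareBlock_def, Matrix.of_apply, Matrix.transpose_apply,
      hM _ _ (hw.trans hv.symm).le]
    simp [Matrix.one_apply, eq_comm]
  rw [this, Matrix.det_one]

/-- The indicator of the vertices that never reach `ρ` is a nonzero kernel vector: it is constant
along `f` and vanishes at `ρ`. -/
theorem det_parentMatrix_of_not_isParentFunction {ρ : V} {f : V → V} (hρ : f ρ = ρ)
    (hf : ¬ IsParentFunction ρ f) : (parentMatrix ρ f).det = 0 := by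
  classical
  have hex : ∃ v, ∀ k, f^[k] v ≠ ρ := by
    by_contra! h
    exact hf ⟨hρ, h⟩
  obtain ⟨v₀, hv₀⟩ := hex
  let c : V → ℝ := fun v => if ∃ k, f^[k] v = ρ then 0 else 1
  have hc : ∀ v, c (f v) = c v := by
    intro v
    have : (∃ k, f^[k] (f v) = ρ) ↔ ∃ k, f^[k] v = ρ := by
      constructor
      · rintro ⟨k, hk⟩
        exact ⟨k + 1, hk⟩
      · rintro ⟨k, hk⟩
        refine ⟨k, ?_⟩
        rw [← Function.iterate_succ_apply, Function.iterate_succ_apply', hk, hρ]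
    simp only [c, this]
  refine Matrix.exists_mulVec_eq_zero_iff.1 ⟨c, ?_, ?_⟩
  · intro h
    have := congrFun h v₀
    simp [c, hv₀] at this
  · ext v
    by_cases hv : v = ρ
    · have : c ρ = 0 := if_pos ⟨0, rfl⟩
      simp [Matrix.mulVec, parentMatrix, hv, this]
    · have hrow : parentMatrix ρ f v = Pi.single v 1 - Pi.single (f v) 1 := if_neg hv
      rw [Matrix.mulVec, hrow, sub_dotProduct, single_one_dotProduct, single_one_dotProduct, hc,
        sub_self, Pi.zero_apply]

/-- The **matrix tree theorem**: the principal cofactors of the Laplacian matrix count the spanning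
trees. -/
theorem adjugate_lapMatrix_diag (G : SimpleGraph V) [DecidableRel G.Adj] (ρ : V) :
    (G.lapMatrix ℝ).adjugate ρ ρ = numSpanningTrees G := by
  classical
  let S : V → Finset V := fun v => if v = ρ then {ρ} else G.neighborFinset v
  -- Row `v ≠ ρ` is the sum of `e_v - e_j` over the neighbours `j` of `v`; multilinearity in the
  -- rows then expands the cofactor over all choices of one neighbour per vertex.
  have hrow : (G.lapMatrix ℝ).updateRow ρ (Pi.single ρ 1) = fun v => ∑ j ∈ S v,
      if v = ρ then (Pi.single ρ 1 : V → ℝ) else Pi.single v 1 - Pi.single j 1 := by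
    ext v w
    by_cases hv : v = ρ
    · subst hv
      simp [S]
    · rw [Matrix.updateRow_ne hv]
      simp [S, hv, Finset.sum_apply, Pi.single_apply, SimpleGraph.lapMatrix,
        SimpleGraph.degMatrix, Matrix.diagonal_apply, eq_comm (a := w)]
  have hexp : (G.lapMatrix ℝ).adjugate ρ ρ =
      ∑ f ∈ Fintype.piFinset S, (parentMatrix ρ f).det := by
    rw [Matrix.adjugate_apply, hrow]
    exact (Matrix.detRowAlternating (R := ℝ) (n := V)).toMultilinearMap.map_sum_finset _ S
  have hmem : ∀ f, f ∈ Fintype.piFinset S ↔ f ρ = ρ ∧ ∀ v, v ≠ ρ → G.Adj v (f v) := by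
    intro f
    rw [Fintype.mem_piFinset]
    constructor
    · intro h
      refine ⟨by simpa [S] using h ρ, fun v hv => by simpa [S, hv] using h v⟩
    · rintro ⟨h1, h2⟩ v
      by_cases hv : v = ρ
      · simp [S, hv, h1]
      · simpa [S, hv] using h2 v hv
  have hsum : ∑ f ∈ Fintype.piFinset S, (parentMatrix ρ f).det =
      (((Fintype.piFinset S).filter (IsParentFunction ρ)).card : ℝ) := by
    rw [Finset.card_filter, Nat.cast_sum]
    refine Finset.sum_congr rfl fun f hf => ?_
    split_ifs with h
    · rw [det_parentMatrix_of_isParentFunction h, Nat.cast_one]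
    · rw [det_parentMatrix_of_not_isParentFunction ((hmem f).1 hf).1 h, Nat.cast_zero]
  have himage : {T : SimpleGraph V | T ≤ G ∧ T.IsTree} =
      functionGraph '' ((Fintype.piFinset S).filter (IsParentFunction ρ) : Finset (V → V)) := by
    ext T
    constructor
    · rintro ⟨hle, hT⟩
      obtain ⟨f, hf, hadj, rfl⟩ := hT.exists_parentFunction ρ
      refine ⟨f, ?_, rfl⟩
      rw [Finset.mem_coe, Finset.mem_filter, hmem]
      exact ⟨⟨hf.1, fun v hv => hle (hadj v hv)⟩, hf⟩
    · rintro ⟨f, hf, rfl⟩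
      rw [Finset.mem_coe, Finset.mem_filter, hmem] at hf
      obtain ⟨⟨hρ, hadj⟩, hf⟩ := hf
      refine ⟨?_, hf.isTree⟩
      rintro v w ⟨hne, h | h⟩
      · have hv : v ≠ ρ := by
          rintro rfl
          exact hne (hρ ▸ h)
        exact h ▸ hadj v hv
      · have hw : w ≠ ρ := by
          rintro rfl
          exact hne (hρ ▸ h).symm
        exact (h ▸ hadj w hw).symm
  rw [hexp, hsum, numSpanningTrees, himage, Set.InjOn.ncard_image, Set.ncard_coe_finset]
  intro f hf g hg h
  rw [Finset.mem_coe, Finset.mem_filter] at hf hg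
  exact hf.2.eq_of_functionGraph_eq hg.2 h

end MatrixTree

/-! ### Rank-one updates and Schur complements -/

section Determinants

variable {V E : Type*} [Fintype V] [DecidableEq V] [Fintype E] [DecidableEq E]

/-- Replacing row `j` by `e_i - e_j` keeps all row sums zero, hence gives a singular matrix, so
`e_i` and `e_j` in that row yield the same determinant. -/
theorem Matrix.adjugate_apply_of_mulVec_one_eq_zero {A : Matrix V V ℝ} (hA : A *ᵥ 1 = 0)
    (i j : V) : A.adjugate i j = A.adjugate j j := by
  have h0 : (A.updateRow j (Pi.single i 1 - Pi.single j 1)).det = 0 := by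
    refine Matrix.exists_mulVec_eq_zero_iff.1 ⟨1, ?_, ?_⟩
    · intro h
      simpa using congrFun h j
    · ext v
      by_cases hv : v = j
      · subst hv
        rw [Matrix.mulVec, Matrix.updateRow_self, sub_dotProduct]
        simp
      · have := congrFun hA v
        simpa [Matrix.mulVec, hv] using this
  have h1 : (Pi.single i 1 : V → ℝ) = Pi.single j 1 + (Pi.single i 1 - Pi.single j 1) := by abel
  rw [Matrix.adjugate_apply, Matrix.adjugate_apply, h1, Matrix.det_updateRow_add, h0, add_zero]

theorem Matrix.dense_setOf_isUnit_add_smul_one (A : Matrix V V ℝ) :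
    Dense {z : ℝ | IsUnit (A + z • (1 : Matrix V V ℝ)).det} := by
  have hfin : {z : ℝ | (-A).charpoly.IsRoot z}.Finite :=
    Polynomial.finite_setOfPred_isRoot (-A).charpoly_monic.ne_zero
  refine (hfin.countable.dense_compl ℝ).mono fun z hz => ?_
  rw [Set.mem_ofPred_eq, isUnit_iff_ne_zero]
  intro h
  apply hz
  rw [Set.mem_ofPred_eq, Polynomial.IsRoot, Matrix.eval_charpoly, ← h]
  congr 1
  rw [sub_neg_eq_add, add_comm, Matrix.scalar_apply, Matrix.smul_one_eq_diagonal]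

/-- The **matrix determinant lemma** for arbitrary real matrices. -/
theorem Matrix.det_add_vecMulVec_real (A : Matrix V V ℝ) (u v : V → ℝ) :
    (A + Matrix.vecMulVec u v).det = A.det + v ⬝ᵥ (A.adjugate *ᵥ u) := by
  have key : ∀ B : Matrix V V ℝ, IsUnit B.det →
      (B + Matrix.vecMulVec u v).det = B.det + v ⬝ᵥ (B.adjugate *ᵥ u) := by
    intro B hB
    rw [Matrix.vecMulVec_eq Unit, Matrix.det_add_replicateCol_mul_replicateRow hB, mul_comm,
      Matrix.det_unique]
    have : B.adjugate = B.det • B⁻¹ := by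
      rw [Matrix.inv_def, smul_smul, Ring.mul_inverse_cancel _ hB, one_smul]
    rw [this, Matrix.smul_mulVec, dotProduct_smul, Matrix.add_apply, Matrix.one_apply_eq,
      Matrix.mul_assoc, ← Matrix.replicateCol_mulVec, Matrix.replicateRow_mul_replicateCol_apply,
      smul_eq_mul, add_mul, one_mul, mul_comm B.det]
  -- Both sides are continuous in the shift `z` and agree on the dense set where `A + zI` is
  -- invertible, hence also at `z = 0`.
  have hc1 : Continuous fun z : ℝ => (A + z • (1 : Matrix V V ℝ) + Matrix.vecMulVec u v).det := by
    fun_prop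
  have hc2 : Continuous fun z : ℝ => (A + z • (1 : Matrix V V ℝ)).det +
      v ⬝ᵥ ((A + z • (1 : Matrix V V ℝ)).adjugate *ᵥ u) := by
    fun_prop
  have := congrFun (hc1.ext_on A.dense_setOf_isUnit_add_smul_one hc2 fun z hz => key _ hz) 0
  simpa using this

theorem SimpleGraph.det_lapMatrix_add_vecMulVec [Nonempty V] (G : SimpleGraph V)
    [DecidableRel G.Adj] (u : V → ℝ) :
    (G.lapMatrix ℝ + Matrix.vecMulVec u u).det = (∑ v, u v) ^ 2 * numSpanningTrees G := by
  have hadj : (G.lapMatrix ℝ).adjugate =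
      Matrix.of fun _ _ => (numSpanningTrees G : ℝ) := by
    ext i j
    rw [Matrix.adjugate_apply_of_mulVec_one_eq_zero G.lapMatrix_mulVec_const_eq_zero,
      adjugate_lapMatrix_diag, Matrix.of_apply]
  rw [Matrix.det_add_vecMulVec_real, G.det_lapMatrix_eq_zero, zero_add, hadj]
  simp only [dotProduct, Matrix.mulVec, Matrix.of_apply, ← Finset.mul_sum, ← Finset.sum_mul]
  ring

theorem Matrix.det_eq_prod_of_basis {n : ℕ} {M : Matrix V V ℝ}
    (x : OrthonormalBasis (Fin n) ℝ (EuclideanSpace ℝ V)) {ν : Fin n → ℝ}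
    (h : ∀ i, M *ᵥ (x i).ofLp = ν i • (x i).ofLp) : M.det = ∏ i, ν i := by
  let b : Module.Basis (Fin n) ℝ (V → ℝ) := x.toBasis.map (WithLp.linearEquiv 2 ℝ (V → ℝ))
  have hb : ∀ i, b i = (x i).ofLp := fun i => by simp [b]
  have hM : LinearMap.toMatrix b b (Matrix.toLin' M) = Matrix.diagonal ν := by
    ext i j
    rw [LinearMap.toMatrix_apply, Matrix.toLin'_apply, hb, h, ← hb, map_smul, b.repr_self,
      Matrix.diagonal_apply]
    by_cases hij : i = j
    · simp [hij]
    · simp [hij]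
  rw [← LinearMap.det_toLin', ← LinearMap.det_toMatrix b, hM, Matrix.det_diagonal]

/-- If `ν 0 ≠ 0`, the matrix factors as `M (I + (s / ν 0) J)`; a shift by `z` and continuity cover
`ν 0 = 0`. The vector `x 0` need not be constant: only its eigenvalue must match that of the
all-ones vector, which suits disconnected graphs. -/
theorem Matrix.det_add_smul_ones {n : ℕ} [NeZero n] (hn : Fintype.card V = n) {M : Matrix V V ℝ}
    (x : OrthonormalBasis (Fin n) ℝ (EuclideanSpace ℝ V)) {ν : Fin n → ℝ}
    (h : ∀ i, M *ᵥ (x i).ofLp = ν i • (x i).ofLp) (h1 : M *ᵥ 1 = ν 0 • 1) (s : ℝ) :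
    (M + s • Matrix.vecMulVec 1 1).det =
      (ν 0 + s * n) * ∏ i ∈ Finset.univ.erase (0 : Fin n), ν i := by
  have key : ∀ (B : Matrix V V ℝ) (μ : Fin n → ℝ),
      (∀ i, B *ᵥ (x i).ofLp = μ i • (x i).ofLp) → B *ᵥ 1 = μ 0 • 1 → μ 0 ≠ 0 →
      (B + s • Matrix.vecMulVec 1 1).det =
        (μ 0 + s * n) * ∏ i ∈ Finset.univ.erase (0 : Fin n), μ i := by
    intro B μ hB hB1 hμ
    have hfac : B + s • Matrix.vecMulVec 1 1 =
        B * (1 + Matrix.vecMulVec ((s / μ 0) • 1) 1) := by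
      rw [Matrix.mul_add, Matrix.mul_one, Matrix.mul_vecMulVec, Matrix.mulVec_smul, hB1,
        smul_smul, div_mul_cancel₀ _ hμ, Matrix.smul_vecMulVec]
    rw [hfac, Matrix.det_mul, Matrix.det_eq_prod_of_basis x hB, Matrix.det_add_vecMulVec_real,
      Matrix.det_one, Matrix.adjugate_one, Matrix.one_mulVec,
      ← Finset.mul_prod_erase Finset.univ μ (Finset.mem_univ 0)]
    simp only [dotProduct_smul, one_dotProduct_one, hn, smul_eq_mul]
    field_simp
  have hc1 : Continuous fun z : ℝ =>
      (M + z • (1 : Matrix V V ℝ) + s • Matrix.vecMulVec 1 1).det := by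
    fun_prop
  have hc2 : Continuous fun z : ℝ =>
      (ν 0 + z + s * n) * ∏ i ∈ Finset.univ.erase (0 : Fin n), (ν i + z) := by
    fun_prop
  have := congrFun (hc1.ext_on (dense_compl_singleton (-ν 0)) hc2 fun z hz => ?_) 0
  · simpa using this
  · refine key _ (fun i => ν i + z) (fun i => ?_) ?_ fun h0 => hz (eq_neg_of_add_eq_zero_right h0)
    · rw [Matrix.add_mulVec, h, Matrix.smul_mulVec, Matrix.one_mulVec, add_smul]
    · rw [Matrix.add_mulVec, h1, Matrix.smul_mulVec, Matrix.one_mulVec, add_smul]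

/-- Adding `BᵀK` times the first block row to the second turns the lower right block into `cI`,
whose Schur complement is explicit. The powers of `c` stay on separate sides to avoid a signed
exponent. -/
theorem Matrix.pow_mul_det_fromBlocks_gram (P K : Matrix V V ℝ) (B : Matrix V E ℝ) {c : ℝ}
    (hc : c ≠ 0) :
    c ^ Fintype.card V * (Matrix.fromBlocks P (-B) (-Bᵀ) (c • 1 + Bᵀ * K * B)).det =
      c ^ Fintype.card E * (c • P + B * Bᵀ * (K * P - 1)).det := by
  have hmul : Matrix.fromBlocks 1 0 (Bᵀ * K) 1 *
      Matrix.fromBlocks P (-B) (-Bᵀ) (c • 1 + Bᵀ * K * B) =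
      Matrix.fromBlocks P (-B) (Bᵀ * (K * P - 1)) (c • 1) := by
    rw [Matrix.fromBlocks_multiply]
    congr 1
    · simp
    · simp
    · rw [Matrix.mul_sub, Matrix.mul_one, Matrix.one_mul, Matrix.mul_assoc, sub_eq_add_neg]
    · simp
  have hdet := congrArg Matrix.det hmul
  rw [Matrix.det_mul, Matrix.det_fromBlocks_zero₁₂, Matrix.det_one, Matrix.det_one, one_mul,
    one_mul] at hdet
  let _ : Invertible (c • (1 : Matrix E E ℝ)) :=
    ⟨c⁻¹ • 1, by simp [smul_smul, hc], by simp [smul_smul, hc]⟩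
  have hinv : ⅟(c • (1 : Matrix E E ℝ)) = c⁻¹ • 1 := rfl
  rw [hdet, Matrix.det_fromBlocks₂₂, hinv, Matrix.det_smul, Matrix.det_one, mul_one,
    mul_left_comm, ← Matrix.det_smul]
  congr 2
  rw [smul_sub]
  simp [smul_smul, hc, Matrix.mul_assoc]

end Determinants

/-! ### Incidence matrices and the block Laplacian -/

section Incidence

variable {V : Type*} [Fintype V] [DecidableEq V] (G : SimpleGraph V) [DecidableRel G.Adj]

/-- The vertex-edge incidence matrix of `G`, with columns indexed by the edges of `G` only. -/
def edgeIncMatrix : Matrix V G.edgeSet ℝ :=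
  Matrix.of fun v e => if v ∈ (e : Sym2 V) then 1 else 0

omit [Fintype V] in
theorem edgeIncMatrix_eq_submatrix :
    edgeIncMatrix G = (G.incMatrix ℝ).submatrix id Subtype.val := by
  ext v e
  simp [edgeIncMatrix, SimpleGraph.incMatrix_apply', SimpleGraph.incidenceSet, e.2]

omit [DecidableEq V] in
theorem SimpleGraph.sum_edgeSet_eq_sum {g : Sym2 V → ℝ} (hg : ∀ e ∉ G.edgeSet, g e = 0) :
    ∑ e : G.edgeSet, g e = ∑ e, g e := by
  rw [← Finset.sum_subtype G.edgeFinset (p := (· ∈ G.edgeSet)) (fun e => by simp) g]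
  exact Finset.sum_subset (Finset.subset_univ _) fun e _ he => hg e (by simpa using he)

theorem edgeIncMatrix_mul_transpose :
    edgeIncMatrix G * (edgeIncMatrix G)ᵀ = G.degMatrix ℝ + G.adjMatrix ℝ := by
  have h : edgeIncMatrix G * (edgeIncMatrix G)ᵀ = G.incMatrix ℝ * (G.incMatrix ℝ)ᵀ := by
    rw [edgeIncMatrix_eq_submatrix]
    ext v w
    simp only [Matrix.mul_apply, Matrix.submatrix_apply, Matrix.transpose_apply, id]
    exact G.sum_edgeSet_eq_sum (g := fun e => G.incMatrix ℝ v e * G.incMatrix ℝ w e) fun e he => by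
      rw [G.incMatrix_of_notMem_incidenceSet fun h => he h.1, zero_mul]
  rw [h, SimpleGraph.incMatrix_mul_transpose]
  ext v w
  by_cases hvw : v = w
  · simp [hvw, SimpleGraph.degMatrix]
  · simp [hvw, SimpleGraph.degMatrix]

theorem sum_edgeIncMatrix_row (v : V) : ∑ e, edgeIncMatrix G v e = G.degree v := by
  rw [edgeIncMatrix_eq_submatrix, ← G.sum_incMatrix_apply]
  exact G.sum_edgeSet_eq_sum (g := fun e => G.incMatrix ℝ v e) fun e he =>
    G.incMatrix_of_notMem_incidenceSet fun h => he h.1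

theorem sum_edgeIncMatrix_col (e : G.edgeSet) : ∑ v, edgeIncMatrix G v e = 2 := by
  rw [edgeIncMatrix_eq_submatrix]
  exact G.sum_incMatrix_apply_of_mem_edgeSet e.2

theorem edgeIncMatrix_transpose_mul [DecidableRel G.lineGraph.Adj] :
    (edgeIncMatrix G)ᵀ * edgeIncMatrix G = (2 : ℝ) • 1 + G.lineGraph.adjMatrix ℝ := by
  ext e f
  rw [Matrix.mul_apply]
  by_cases hef : e = f
  · subst hef
    rw [Matrix.add_apply, SimpleGraph.adjMatrix_apply, if_neg (G.lineGraph.loopless.irrefl e),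
      Matrix.smul_apply, Matrix.one_apply_eq, smul_eq_mul, mul_one, add_zero,
      ← sum_edgeIncMatrix_col G e]
    refine Finset.sum_congr rfl fun v _ => ?_
    simp [edgeIncMatrix]
  · rw [Matrix.add_apply, SimpleGraph.adjMatrix_apply, Matrix.smul_apply,
      Matrix.one_apply_ne hef, smul_zero, zero_add]
    split_ifs with h
    -- Distinct edges of a simple graph share at most one end, so the sum has a single nonzero term.
    · obtain ⟨_, v, hve, hvf⟩ := SimpleGraph.lineGraph_adj_iff_exists.1 h
      rw [Finset.sum_eq_single v]
      · simp [edgeIncMatrix, hve, hvf]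
      · intro w _ hw
        have : ¬ (w ∈ (e : Sym2 V) ∧ w ∈ (f : Sym2 V)) := by
          rintro ⟨hwe, hwf⟩
          apply hef
          rw [Subtype.ext_iff, (Sym2.mem_and_mem_iff hw).1 ⟨hwe, hve⟩,
            (Sym2.mem_and_mem_iff hw).1 ⟨hwf, hvf⟩]
        simp only [edgeIncMatrix, Matrix.transpose_apply, Matrix.of_apply]
        split_ifs <;> simp_all
      · simp
    · refine Finset.sum_eq_zero fun w _ => ?_
      have : ¬ (w ∈ (e : Sym2 V) ∧ w ∈ (f : Sym2 V)) := fun hw =>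
        h (SimpleGraph.lineGraph_adj_iff_exists.2 ⟨hef, w, hw⟩)
      simp only [edgeIncMatrix, Matrix.transpose_apply, Matrix.of_apply]
      split_ifs <;> simp_all

theorem lapMatrix_apply_eq_sum {W : Type*} [Fintype W] [DecidableEq W] (H : SimpleGraph W)
    [DecidableRel H.Adj] (v w : W) : H.lapMatrix ℝ v w =
      (if v = w then ∑ u, H.adjMatrix ℝ v u else 0) - H.adjMatrix ℝ v w := by
  simp [SimpleGraph.lapMatrix, SimpleGraph.degMatrix, Matrix.diagonal_apply,
    SimpleGraph.degree_eq_sum_if_adj]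

theorem lapMatrix_mergedSubdivision (H₁ : SimpleGraph V) (H₂ : SimpleGraph G.edgeSet)
    [DecidableRel H₁.Adj] [DecidableRel H₂.Adj] [DecidableRel (mergedSubdivision G H₁ H₂).Adj] :
    (mergedSubdivision G H₁ H₂).lapMatrix ℝ =
      Matrix.fromBlocks (G.degMatrix ℝ + H₁.lapMatrix ℝ) (-edgeIncMatrix G) (-(edgeIncMatrix G)ᵀ)
        ((2 : ℝ) • 1 + H₂.lapMatrix ℝ) := by
  have hA : (mergedSubdivision G H₁ H₂).adjMatrix ℝ =
      Matrix.fromBlocks (H₁.adjMatrix ℝ) (edgeIncMatrix G) (edgeIncMatrix G)ᵀ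
        (H₂.adjMatrix ℝ) := by
    ext (u | e) (v | f) <;>
      simp only [SimpleGraph.adjMatrix_apply, Matrix.fromBlocks_apply₁₁,
        Matrix.fromBlocks_apply₁₂, Matrix.fromBlocks_apply₂₁, Matrix.fromBlocks_apply₂₂,
        edgeIncMatrix, Matrix.transpose_apply, Matrix.of_apply] <;>
      exact if_congr Iff.rfl rfl rfl
  ext (u | e) (v | f)
  · rw [lapMatrix_apply_eq_sum, hA]
    simp only [Fintype.sum_sum_type, Matrix.fromBlocks_apply₁₁, Matrix.fromBlocks_apply₁₂,
      Matrix.add_apply, lapMatrix_apply_eq_sum, sum_edgeIncMatrix_row, SimpleGraph.degMatrix,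
      Matrix.diagonal_apply, Sum.inl.injEq]
    split_ifs <;> ring
  · rw [lapMatrix_apply_eq_sum, hA]
    simp
  · rw [lapMatrix_apply_eq_sum, hA]
    simp
  · rw [lapMatrix_apply_eq_sum, hA]
    simp only [Fintype.sum_sum_type, Matrix.fromBlocks_apply₂₂, Matrix.fromBlocks_apply₂₁,
      Matrix.add_apply, lapMatrix_apply_eq_sum, sum_edgeIncMatrix_col, Matrix.transpose_apply,
      Matrix.smul_apply, Matrix.one_apply, Sum.inr.injEq]
    split_ifs <;> simp <;> ring

end Incidence

/-! ### Common eigenbases of commuting symmetric operators -/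

theorem OrthogonalFamily.exists_subordinate_orthonormalBasis {E ι : Type*}
    [NormedAddCommGroup E] [InnerProductSpace ℝ E] [FiniteDimensional ℝ E] [Finite ι]
    {W : ι → Submodule ℝ E} (hW : OrthogonalFamily ℝ (fun i => W i) fun i => (W i).subtypeₗᵢ)
    (htop : iSup W = ⊤) {n : ℕ} (hn : Module.finrank ℝ E = n) :
    ∃ (x : OrthonormalBasis (Fin n) ℝ E) (k : Fin n → ι), ∀ i, x i ∈ W (k i) := by
  classical
  cases nonempty_fintype ι
  have hint : DirectSum.IsInternal W := by
    rw [hW.isInternal_iff, htop, Submodule.top_orthogonal_eq_bot]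
  exact ⟨hint.subordinateOrthonormalBasis hn hW,
    fun i => hint.subordinateOrthonormalBasisIndex hn i hW,
    fun i => hint.subordinateOrthonormalBasis_subordinate hn i hW⟩

theorem LinearMap.IsSymmetric.exists_orthonormalBasis_of_commute {E : Type*}
    [NormedAddCommGroup E] [InnerProductSpace ℝ E] [FiniteDimensional ℝ E] {S T : E →ₗ[ℝ] E}
    (hS : S.IsSymmetric) (hT : T.IsSymmetric) (hST : Commute S T) {n : ℕ}
    (hn : Module.finrank ℝ E = n) :
    ∃ (x : OrthonormalBasis (Fin n) ℝ E) (α β : Fin n → ℝ),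
      (∀ i, S (x i) = α i • x i) ∧ ∀ i, T (x i) = β i • x i := by
  -- Indexing by actual eigenvalues rather than all reals makes the family of joint eigenspaces
  -- finite.
  have hfin : ∀ R : E →ₗ[ℝ] E, Finite {a : ℝ // Module.End.HasEigenvalue R a} := fun R =>
    inferInstanceAs (Finite (Module.End.Eigenvalues R))
  have hfS := hfin S
  have hfT := hfin T
  have htop : (⨆ i : {a : ℝ // Module.End.HasEigenvalue S a} ×
      {b : ℝ // Module.End.HasEigenvalue T b},
      Module.End.eigenspace S i.1.1 ⊓ Module.End.eigenspace T i.2.1) = ⊤ := by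
    rw [eq_top_iff, ← hS.iSup_iSup_eigenspace_inf_eigenspace_eq_top_of_commute hT hST]
    refine iSup_le fun a => iSup_le fun b => ?_
    by_cases ha : Module.End.HasEigenvalue S a
    · by_cases hb : Module.End.HasEigenvalue T b
      · exact le_iSup (fun i : {a : ℝ // Module.End.HasEigenvalue S a} ×
          {b : ℝ // Module.End.HasEigenvalue T b} =>
          Module.End.eigenspace S i.1.1 ⊓ Module.End.eigenspace T i.2.1) (⟨a, ha⟩, ⟨b, hb⟩)
      · rw [Module.End.hasEigenvalue_iff, not_not] at hb
        rw [hb, inf_bot_eq]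
        exact bot_le
    · rw [Module.End.hasEigenvalue_iff, not_not] at ha
      rw [ha, bot_inf_eq]
      exact bot_le
  have hinj : Function.Injective fun i : {a : ℝ // Module.End.HasEigenvalue S a} ×
      {b : ℝ // Module.End.HasEigenvalue T b} => (i.2.1, i.1.1) := by
    rintro ⟨a, b⟩ ⟨c, d⟩ h
    rw [Prod.mk.injEq] at h
    exact Prod.ext (Subtype.ext h.2) (Subtype.ext h.1)
  obtain ⟨x, k, hx⟩ := OrthogonalFamily.exists_subordinate_orthonormalBasis
    ((hS.orthogonalFamily_eigenspace_inf_eigenspace hT).comp hinj) htop hn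
  exact ⟨x, fun i => (k i).1, fun i => (k i).2,
    fun i => Module.End.mem_eigenspace_iff.1 (hx i).1,
    fun i => Module.End.mem_eigenspace_iff.1 (hx i).2⟩

section JointSpectrum

variable {V : Type*} [Fintype V] [DecidableEq V]

theorem Matrix.IsSymm.exists_orthonormalBasis_of_commute {n : ℕ} (hn : Fintype.card V = n)
    {A B : Matrix V V ℝ} (hA : A.IsSymm) (hB : B.IsSymm) (hAB : A * B = B * A) :
    ∃ (x : OrthonormalBasis (Fin n) ℝ (EuclideanSpace ℝ V)) (α β : Fin n → ℝ),
      (∀ i, A *ᵥ (x i).ofLp = α i • (x i).ofLp) ∧ ∀ i, B *ᵥ (x i).ofLp = β i • (x i).ofLp := by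
  have hcomm : Commute (Matrix.toEuclideanLin A) (Matrix.toEuclideanLin B) := by
    show Matrix.toEuclideanLin A ∘ₗ Matrix.toEuclideanLin B =
      Matrix.toEuclideanLin B ∘ₗ Matrix.toEuclideanLin A
    rw [← Matrix.toLpLin_mul, ← Matrix.toLpLin_mul, hAB]
  obtain ⟨x, α, β, hα, hβ⟩ := LinearMap.IsSymmetric.exists_orthonormalBasis_of_commute
    (Matrix.isSymmetric_toEuclideanLin_iff.2 hA) (Matrix.isSymmetric_toEuclideanLin_iff.2 hB)
    hcomm (finrank_euclideanSpace.trans hn)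
  exact ⟨x, α, β, fun i => congrArg WithLp.ofLp (hα i), fun i => congrArg WithLp.ofLp (hβ i)⟩

omit [DecidableEq V] in
theorem Matrix.IsSymm.eigenvalue_eq_zero_of_sum_ne_zero {A : Matrix V V ℝ} (hA : A.IsSymm)
    (hA1 : A *ᵥ 1 = 0) {v : V → ℝ} {α : ℝ} (hv : A *ᵥ v = α • v) (h1 : 1 ⬝ᵥ v ≠ 0) : α = 0 := by
  have h : 1 ⬝ᵥ (A *ᵥ v) = 0 := by
    rw [Matrix.dotProduct_mulVec, ← Matrix.mulVec_transpose, hA.eq, hA1, zero_dotProduct]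
  rw [hv, dotProduct_smul, smul_eq_mul] at h
  exact (mul_eq_zero.1 h).resolve_right h1

omit [DecidableEq V] in
theorem OrthonormalBasis.exists_sum_ne_zero [Nonempty V] {n : ℕ}
    (x : OrthonormalBasis (Fin n) ℝ (EuclideanSpace ℝ V)) : ∃ i, 1 ⬝ᵥ (x i).ofLp ≠ 0 := by
  by_contra! h
  have h0 : (WithLp.toLp 2 1 : EuclideanSpace ℝ V) = 0 := by
    rw [← x.sum_repr' (WithLp.toLp 2 1)]
    refine Finset.sum_eq_zero fun i _ => ?_
    have : inner ℝ (x i) (WithLp.toLp 2 1 : EuclideanSpace ℝ V) = 1 ⬝ᵥ (x i).ofLp := by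
      simp [EuclideanSpace.inner_eq_star_dotProduct]
    rw [this, h, zero_smul]
  have := congrFun (congrArg WithLp.ofLp h0) (Classical.arbitrary V)
  simp at this

/-- The only issue is the degree matrix of `H`. Commutation gives `A_G (A_H 1) = r A_H 1`, so the
degree vector of `H` lies in the kernel of `L(G)`. It is thus constant along edges of `G`, which
makes `A_G` commute with `D_H`. -/
theorem SimpleGraph.commute_lapMatrix {G H : SimpleGraph V} [DecidableRel G.Adj]
    [DecidableRel H.Adj] {r : ℕ} (hG : G.IsRegularOfDegree r) (hGH : CommutingGraphs G H) :
    G.lapMatrix ℝ * H.lapMatrix ℝ = H.lapMatrix ℝ * G.lapMatrix ℝ := by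
  have hdeg : G.degMatrix ℝ = (r : ℝ) • 1 := by
    rw [SimpleGraph.degMatrix, Matrix.smul_one_eq_diagonal]
    simp [hG.degree_eq]
  have hGv : ∀ v : V → ℝ, G.lapMatrix ℝ *ᵥ v = (r : ℝ) • v - G.adjMatrix ℝ *ᵥ v := by
    intro v
    rw [SimpleGraph.lapMatrix, hdeg, Matrix.sub_mulVec, Matrix.smul_mulVec, Matrix.one_mulVec]
  have hG1 : G.adjMatrix ℝ *ᵥ 1 = (r : ℝ) • 1 := by
    ext v
    simp [SimpleGraph.adjMatrix_mulVec_apply, hG.degree_eq]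
  have hH1 : H.adjMatrix ℝ *ᵥ 1 = fun v => (H.degree v : ℝ) := by
    ext v
    simp [SimpleGraph.adjMatrix_mulVec_apply]
  have hker : G.lapMatrix ℝ *ᵥ (fun v => (H.degree v : ℝ)) = 0 := by
    rw [hGv, ← hH1, Matrix.mulVec_mulVec, hGH, ← Matrix.mulVec_mulVec, hG1, Matrix.mulVec_smul,
      sub_self]
  have hconst := (G.lapMatrix_mulVec_eq_zero_iff_forall_adj).1 hker
  have hAD : G.adjMatrix ℝ * H.degMatrix ℝ = H.degMatrix ℝ * G.adjMatrix ℝ := by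
    ext v w
    rw [SimpleGraph.degMatrix, Matrix.mul_diagonal, Matrix.diagonal_mul,
      SimpleGraph.adjMatrix_apply]
    split_ifs with h
    · rw [one_mul, mul_one, hconst v w h]
    · simp
  have hAL : G.adjMatrix ℝ * H.lapMatrix ℝ = H.lapMatrix ℝ * G.adjMatrix ℝ := by
    rw [SimpleGraph.lapMatrix, Matrix.mul_sub, Matrix.sub_mul, hAD, hGH]
  rw [show G.lapMatrix ℝ = G.degMatrix ℝ - G.adjMatrix ℝ from rfl, hdeg, Matrix.sub_mul, Matrix.mul_sub, hAL]
  simp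

theorem exists_isJointLaplacianSpectrum {G H : SimpleGraph V} [DecidableRel G.Adj]
    [DecidableRel H.Adj] {n : ℕ} [NeZero n] (hn : Fintype.card V = n)
    (hGH : G.lapMatrix ℝ * H.lapMatrix ℝ = H.lapMatrix ℝ * G.lapMatrix ℝ) :
    ∃ μG μH : Fin n → ℝ, IsJointLaplacianSpectrum G H μG μH := by
  obtain ⟨x, α, β, hα, hβ⟩ :=
    (G.isSymm_lapMatrix (R := ℝ)).exists_orthonormalBasis_of_commute hn (H.isSymm_lapMatrix (R := ℝ)) hGH
  have : Nonempty V := Fintype.card_pos_iff.1 (hn ▸ NeZero.pos n)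
  -- A basis vector not orthogonal to the all-ones vector has eigenvalue `0` for both Laplacians at
  -- once; it is swapped into position `0`.
  obtain ⟨i, hi⟩ := x.exists_sum_ne_zero
  let e := Equiv.swap 0 i
  refine ⟨α ∘ e, β ∘ e, ⟨x.reindex e.symm, fun k => ?_, fun k => ?_⟩, ?_, ?_⟩
  · simpa using hα (e k)
  · simpa using hβ (e k)
  · simpa [e] using (G.isSymm_lapMatrix (R := ℝ)).eigenvalue_eq_zero_of_sum_ne_zero
      G.lapMatrix_mulVec_const_eq_zero (hα i) hi
  · simpa [e] using (H.isSymm_lapMatrix (R := ℝ)).eigenvalue_eq_zero_of_sum_ne_zero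
      H.lapMatrix_mulVec_const_eq_zero (hβ i) hi

theorem exists_isLaplacianSpectrum (H : SimpleGraph V) [DecidableRel H.Adj] {n : ℕ} [NeZero n]
    (hn : Fintype.card V = n) : ∃ μ : Fin n → ℝ, IsLaplacianSpectrum H μ := by
  obtain ⟨μ, _, ⟨x, hx, _⟩, h0, _⟩ := exists_isJointLaplacianSpectrum (G := H) (H := H) hn rfl
  exact ⟨μ, ⟨x, hx⟩, h0⟩

end JointSpectrum

/-! ### Merged subdivisions of regular graphs -/

section Regular

variable {V : Type*} [Fintype V] [DecidableEq V]

theorem lapMatrix_eq_of_adjMatrix_mulVec_one {W : Type*} [Fintype W] [DecidableEq W]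
    {H : SimpleGraph W} [DecidableRel H.Adj] {d : ℝ} (hd : H.adjMatrix ℝ *ᵥ 1 = d • 1) :
    H.lapMatrix ℝ = d • 1 - H.adjMatrix ℝ := by
  rw [SimpleGraph.lapMatrix]
  congr 1
  rw [SimpleGraph.degMatrix, Matrix.smul_one_eq_diagonal]
  congr 1
  ext v
  simpa [SimpleGraph.adjMatrix_mulVec_apply] using congrFun hd v

theorem transpose_edgeIncMatrix_mulVec_one (G : SimpleGraph V) :
    (edgeIncMatrix G)ᵀ *ᵥ 1 = (2 : ℝ) • 1 := by
  classical
  ext e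
  simpa [Matrix.mulVec, dotProduct] using sum_edgeIncMatrix_col G e

theorem edgeIncMatrix_gram_ones (G : SimpleGraph V) :
    (edgeIncMatrix G)ᵀ * (Matrix.vecMulVec 1 1 : Matrix V V ℝ) * edgeIncMatrix G =
      (4 : ℝ) • Matrix.vecMulVec 1 1 := by
  rw [Matrix.mul_vecMulVec, Matrix.vecMulVec_mul, ← Matrix.mulVec_transpose,
    transpose_edgeIncMatrix_mulVec_one, Matrix.smul_vecMulVec, Matrix.vecMulVec_smul, smul_smul]
  norm_num

theorem SimpleGraph.one_vecMul_lapMatrix (H : SimpleGraph V) [DecidableRel H.Adj] :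
    1 ᵥ* H.lapMatrix ℝ = 0 := by
  rw [← Matrix.mulVec_transpose, (H.isSymm_lapMatrix (R := ℝ)).eq]
  exact H.lapMatrix_mulVec_const_eq_zero

/-- Common source of the three regular formulas. The condition `habc` is what `hH₂` says on the
all-ones vector when there are edges. -/
theorem numSpanningTrees_mergedSubdivision_of_regular {G H : SimpleGraph V} [DecidableRel G.Adj]
    [DecidableRel H.Adj] {n m r : ℕ} [NeZero n] (hn : Fintype.card V = n)
    (hm : Fintype.card G.edgeSet = m) (hr : G.IsRegularOfDegree r) {μG μH : Fin n → ℝ}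
    (hμ : IsJointLaplacianSpectrum G H μG μH) (H₂ : SimpleGraph G.edgeSet) [DecidableRel H₂.Adj]
    {a b c : ℝ} (hc : c ≠ 0)
    (hH₂ : (2 : ℝ) • 1 + H₂.lapMatrix ℝ = c • 1 +
      (edgeIncMatrix G)ᵀ * (a • 1 - b • Matrix.vecMulVec 1 1 : Matrix V V ℝ) * edgeIncMatrix G)
    (habc : c + 2 * r * a - 2 * r * b * n = 2) :
    (numSpanningTrees (mergedSubdivision G H H₂) : ℝ) =
      c ^ ((m : ℤ) - (n : ℤ)) * (2 / (n : ℝ)) *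
        ∏ i ∈ Finset.univ.erase (0 : Fin n),
          ((c + a * (2 * r - μG i)) * (r + μH i) - (2 * r - μG i)) := by
  classical
  obtain ⟨⟨x, hxG, hxH⟩, hG0, hH0⟩ := hμ
  have : Nonempty V := Fintype.card_pos_iff.1 (hn ▸ NeZero.pos n)
  set B := edgeIncMatrix G with hB
  set J : Matrix V V ℝ := Matrix.vecMulVec 1 1 with hJ
  have hdeg : G.degMatrix ℝ = (r : ℝ) • 1 := by
    rw [SimpleGraph.degMatrix, Matrix.smul_one_eq_diagonal]
    simp [hr.degree_eq]
  set P₀ : Matrix V V ℝ := (r : ℝ) • 1 + H.lapMatrix ℝ with hP₀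
  set Q : Matrix V V ℝ := (2 * r : ℝ) • 1 - G.lapMatrix ℝ with hQ
  have hBB : B * Bᵀ = Q := by
    rw [hB, edgeIncMatrix_mul_transpose, hQ, SimpleGraph.lapMatrix, hdeg]
    module
  set M : Matrix V V ℝ := c • P₀ + a • (Q * P₀) - Q with hM
  -- Updating by the indicator of the original vertices adds `J` to the vertex block only and
  -- contributes the factor `n²`.
  have hu : Matrix.vecMulVec (Sum.elim 1 0) (Sum.elim 1 0) =
      Matrix.fromBlocks J 0 0 (0 : Matrix G.edgeSet G.edgeSet ℝ) := by
    ext (i | i) (k | k) <;> simp [hJ, Matrix.vecMulVec_apply]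
  have htree := (mergedSubdivision G H H₂).det_lapMatrix_add_vecMulVec
    (Sum.elim (1 : V → ℝ) 0)
  have hsum : ∑ v, (Sum.elim (1 : V → ℝ) (0 : G.edgeSet → ℝ)) v = n := by
    simp [hn]
  rw [hsum, lapMatrix_mergedSubdivision, hu, Matrix.fromBlocks_add, add_zero, add_zero, add_zero,
    hdeg, ← hP₀, hH₂, ← hB] at htree
  have hdet := Matrix.pow_mul_det_fromBlocks_gram (P₀ + J) (a • 1 - b • J) B hc
  have hQ1 : Q *ᵥ 1 = (2 * r : ℝ) • 1 := by
    rw [hQ, Matrix.sub_mulVec, Matrix.smul_mulVec, Matrix.one_mulVec]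
    erw [G.lapMatrix_mulVec_const_eq_zero]
    rw [sub_zero]
  have hP1 : P₀ *ᵥ 1 = (r : ℝ) • 1 := by
    rw [hP₀, Matrix.add_mulVec, Matrix.smul_mulVec, Matrix.one_mulVec]
    erw [H.lapMatrix_mulVec_const_eq_zero]
    rw [add_zero]
  have hQJ : Q * J = (2 * r : ℝ) • J := by
    rw [hJ, Matrix.mul_vecMulVec, hQ1, Matrix.smul_vecMulVec]
  have hJP : J * P₀ = (r : ℝ) • J := by
    rw [hJ, Matrix.vecMulVec_mul, hP₀, Matrix.vecMul_add, H.one_vecMul_lapMatrix,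
      Matrix.vecMul_smul, Matrix.vecMul_one, add_zero, Matrix.vecMulVec_smul]
  have hJJ : J * J = (n : ℝ) • J := by
    rw [hJ, Matrix.vecMulVec_mul_vecMulVec]
    simp [hn]
  have hmat : c • (P₀ + J) + B * Bᵀ * ((a • 1 - b • J) * (P₀ + J) - 1) =
      M + (c + 2 * r * a - 2 * r * b * (r + n)) • J := by
    rw [hBB, hM]
    simp only [Matrix.sub_mul, Matrix.mul_sub, Matrix.mul_add, Matrix.smul_mul, Matrix.mul_smul,
      Matrix.one_mul, Matrix.mul_one, hJP, hJJ, hQJ]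
    module
  have hMx : ∀ i, M *ᵥ (x i).ofLp =
      ((c + a * (2 * r - μG i)) * (r + μH i) - (2 * r - μG i)) • (x i).ofLp := by
    intro i
    have h1 : P₀ *ᵥ (x i).ofLp = (r + μH i) • (x i).ofLp := by
      rw [hP₀, Matrix.add_mulVec, Matrix.smul_mulVec, Matrix.one_mulVec, hxH, add_smul]
    have h2 : Q *ᵥ (x i).ofLp = (2 * r - μG i) • (x i).ofLp := by
      rw [hQ, Matrix.sub_mulVec, Matrix.smul_mulVec, Matrix.one_mulVec, hxG, sub_smul]
    rw [hM, Matrix.sub_mulVec, Matrix.add_mulVec, Matrix.smul_mulVec, Matrix.smul_mulVec,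
      ← Matrix.mulVec_mulVec, h1, Matrix.mulVec_smul, h2]
    module
  have hM1 : M *ᵥ 1 = ((c + a * (2 * r - μG 0)) * (r + μH 0) - (2 * r - μG 0)) • 1 := by
    rw [hM, Matrix.sub_mulVec, Matrix.add_mulVec, Matrix.smul_mulVec, Matrix.smul_mulVec,
      ← Matrix.mulVec_mulVec, hP1, Matrix.mulVec_smul, hQ1, hG0, hH0]
    module
  rw [htree, hmat, Matrix.det_add_smul_ones hn x hMx hM1, hG0, hH0, hn, hm] at hdet
  have hn0 : (n : ℝ) ≠ 0 := Nat.cast_ne_zero.2 (NeZero.ne n)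
  -- The factor belonging to the all-ones vector collapses to `2n`; against `n²` it leaves the `2 /
  -- n` of the formula.
  have hfac : (c + a * (2 * r - 0)) * (r + 0) - (2 * r - 0) +
      (c + 2 * r * a - 2 * r * b * (r + n)) * n = 2 * (n : ℝ) := by
    linear_combination (r + n : ℝ) * habc
  rw [hfac] at hdet
  rw [zpow_sub₀ hc, zpow_natCast, zpow_natCast]
  have hcn : c ^ n ≠ 0 := pow_ne_zero _ hc
  generalize (∏ i ∈ Finset.univ.erase (0 : Fin n), _ : ℝ) = p at hdet ⊢
  field_simp
  apply mul_left_cancel₀ hn0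
  linear_combination hdet

theorem two_smul_one_add_lapMatrix_top {W : Type*} [Fintype W] [DecidableEq W]
    [DecidableRel (⊤ : SimpleGraph W).Adj] :
    (2 : ℝ) • 1 + (⊤ : SimpleGraph W).lapMatrix ℝ =
      ((Fintype.card W : ℝ) + 2) • 1 - Matrix.vecMulVec 1 1 := by
  have hA : (⊤ : SimpleGraph W).adjMatrix ℝ = Matrix.vecMulVec 1 1 - 1 := by
    ext v w
    by_cases h : v = w <;> simp [h]
  have hd : (⊤ : SimpleGraph W).adjMatrix ℝ *ᵥ 1 = ((Fintype.card W : ℝ) - 1) • 1 := by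
    ext v
    rw [hA, Matrix.sub_mulVec]
    simp [Matrix.mulVec, dotProduct]
  rw [lapMatrix_eq_of_adjMatrix_mulVec_one hd, hA]
  module

theorem two_smul_one_add_lapMatrix_compl_lineGraph {G : SimpleGraph V} [DecidableRel G.Adj]
    {r : ℕ} (hr : G.IsRegularOfDegree r) [DecidableRel G.lineGraphᶜ.Adj] :
    (2 : ℝ) • 1 + G.lineGraphᶜ.lapMatrix ℝ =
      ((Fintype.card G.edgeSet : ℝ) - 2 * r + 2) • 1 - Matrix.vecMulVec 1 1 +
        (edgeIncMatrix G)ᵀ * edgeIncMatrix G := by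
  classical
  have hA : G.lineGraphᶜ.adjMatrix ℝ =
      Matrix.vecMulVec 1 1 + 1 - (edgeIncMatrix G)ᵀ * edgeIncMatrix G := by
    rw [edgeIncMatrix_transpose_mul]
    ext e f
    by_cases h : e = f
    · simp [h]
      norm_num
    · by_cases h' : G.lineGraph.Adj e f <;> simp [h, h']
  have hB1 : edgeIncMatrix G *ᵥ 1 = (r : ℝ) • 1 := by
    ext v
    simpa [Matrix.mulVec, dotProduct, hr.degree_eq] using sum_edgeIncMatrix_row G v
  have hd : G.lineGraphᶜ.adjMatrix ℝ *ᵥ 1 =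
      ((Fintype.card G.edgeSet : ℝ) + 1 - 2 * r) • 1 := by
    rw [hA, Matrix.sub_mulVec, Matrix.add_mulVec, ← Matrix.mulVec_mulVec, hB1, Matrix.mulVec_smul,
      transpose_edgeIncMatrix_mulVec_one, Matrix.one_mulVec]
    ext e
    simp [Matrix.mulVec, dotProduct]
    ring
  rw [lapMatrix_eq_of_adjMatrix_mulVec_one hd, hA]
  module

omit [DecidableEq V] in
theorem SimpleGraph.IsRegularOfDegree.card_mul_eq {G : SimpleGraph V} [DecidableRel G.Adj] {r : ℕ}
    (hr : G.IsRegularOfDegree r) : Fintype.card V * r = 2 * Fintype.card G.edgeSet := by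
  have := G.sum_degrees_eq_twice_card_edges
  simpa [hr.degree_eq, SimpleGraph.edgeFinset_card] using this

omit [DecidableEq V] in
theorem SimpleGraph.IsRegularOfDegree.two_mul_lt_card_edgeSet_add_two [Nonempty V]
    {G : SimpleGraph V} [DecidableRel G.Adj] {r : ℕ} (hr : G.IsRegularOfDegree r) :
    2 * r < Fintype.card G.edgeSet + 2 := by
  have h1 := hr.card_mul_eq
  have h2 : r < Fintype.card V := by
    rw [← hr.degree_eq (Classical.arbitrary V)]
    exact G.degree_lt_card_verts _
  have h3 : (r + 1) * r ≤ 2 * Fintype.card G.edgeSet := h1 ▸ Nat.mul_le_mul_right r h2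
  zify at h3 ⊢
  -- From `r(r + 1) ≤ 2m` it suffices that `r² - 3r + 4 > 0`, and four times this is `(2r - 3)² +
  -- 7`.
  nlinarith [sq_nonneg (2 * (r : ℤ) - 3)]

end Regular

/-! ### Merged subdivisions of stars -/

section Star

theorem numSpanningTrees_mergedSubdivision_star {W : Type*} [Fintype W] [DecidableEq W]
    (H : SimpleGraph W) [DecidableRel H.Adj] {m : ℕ} [NeZero m] (hm : Fintype.card W = m)
    (ψ : (completeBipartiteGraph (Fin 1) (Fin m)).edgeSet ≃ W) {μ : Fin m → ℝ}
    (hμ : IsLaplacianSpectrum H μ) :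
    (numSpanningTrees
        (mergedSubdivision (completeBipartiteGraph (Fin 1) (Fin m)) ⊥ (H.comap ψ)) : ℝ) =
      ∏ i ∈ Finset.univ.erase (0 : Fin m), (μ i + 1) := by
  classical
  obtain ⟨⟨x, hx⟩, h0⟩ := hμ
  let G := completeBipartiteGraph (Fin 1) (Fin m)
  -- Updating at the centre alone makes the vertex block `I + m ρρᵀ`, with an explicit inverse and
  -- determinant `m + 1`; the latter cancels the factor `1 - m / (m + 1)` from the Schur complement.
  let ρ : Fin 1 ⊕ Fin m → ℝ := Pi.single (Sum.inl 0) 1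
  set B := edgeIncMatrix G with hB
  have hmem : ∀ e : G.edgeSet, Sum.inl 0 ∈ (e : Sym2 (Fin 1 ⊕ Fin m)) := by
    rintro ⟨e, he⟩
    induction e with
    | _ v w =>
      have hadj : (completeBipartiteGraph (Fin 1) (Fin m)).Adj v w := he
      rcases v with v | v <;> rcases w with w | w <;>
        simp_all [Subsingleton.elim _ (0 : Fin 1)]
  have hline : G.lineGraph = ⊤ := by
    ext e f
    rw [SimpleGraph.lineGraph_adj_iff_exists, SimpleGraph.top_adj]
    exact ⟨fun h => h.1, fun h => ⟨h, _, hmem e, hmem f⟩⟩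
  have hBB : Bᵀ * B = 1 + Matrix.vecMulVec 1 1 := by
    rw [hB, edgeIncMatrix_transpose_mul, hline]
    ext e f
    by_cases h : e = f
    · simp [h]
      norm_num
    · simp [h]
  have hBρ : Bᵀ *ᵥ ρ = 1 := by
    ext e
    simp [ρ, hB, edgeIncMatrix, hmem]
  have hBρ' : ρ ᵥ* B = 1 := by rw [← Matrix.mulVec_transpose, hBρ]
  have hρρ : ρ ⬝ᵥ ρ = 1 := by simp [ρ]
  have hm1 : (m : ℝ) + 1 ≠ 0 := by positivity
  have hP : G.degMatrix ℝ + (⊥ : SimpleGraph (Fin 1 ⊕ Fin m)).lapMatrix ℝ +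
      Matrix.vecMulVec ρ ρ = 1 + (m : ℝ) • Matrix.vecMulVec ρ ρ := by
    have hbot : (⊥ : SimpleGraph (Fin 1 ⊕ Fin m)).lapMatrix ℝ = 0 := by
      simp [SimpleGraph.lapMatrix, SimpleGraph.degMatrix]
    rw [hbot, add_zero]
    ext v w
    rw [SimpleGraph.degMatrix, Matrix.add_apply, Matrix.diagonal_apply,
      SimpleGraph.degree_eq_sum_if_adj, Fintype.sum_sum_type]
    rcases v with v | v <;> rcases w with w | w <;>
      simp [G, ρ, Matrix.vecMulVec_apply, Matrix.one_apply, Subsingleton.elim _ (0 : Fin 1),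
        add_comm]
  have hu : Matrix.vecMulVec (Sum.elim ρ 0) (Sum.elim ρ 0) =
      Matrix.fromBlocks (Matrix.vecMulVec ρ ρ) 0 0 (0 : Matrix G.edgeSet G.edgeSet ℝ) := by
    ext (i | i) (k | k) <;> simp [Matrix.vecMulVec_apply]
  have htree := (mergedSubdivision G ⊥ (H.comap ψ)).det_lapMatrix_add_vecMulVec (Sum.elim ρ 0)
  have hsum : ∑ v, (Sum.elim ρ (0 : G.edgeSet → ℝ)) v = 1 := by
    simp [ρ]
  have hinvmul : (1 + (m : ℝ) • Matrix.vecMulVec ρ ρ) *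
      (1 - ((m : ℝ) / (m + 1)) • Matrix.vecMulVec ρ ρ) = 1 := by
    simp only [Matrix.mul_sub, Matrix.add_mul, Matrix.smul_mul, Matrix.mul_smul,
      Matrix.one_mul, Matrix.mul_one, Matrix.vecMulVec_mul_vecMulVec, hρρ, one_smul]
    match_scalars
    · ring
    · field_simp
      ring
  let _ : Invertible (1 + (m : ℝ) • Matrix.vecMulVec ρ ρ) :=
    ⟨_, mul_eq_one_comm.1 hinvmul, hinvmul⟩
  have hinv : ⅟(1 + (m : ℝ) • Matrix.vecMulVec ρ ρ) =
      1 - ((m : ℝ) / (m + 1)) • Matrix.vecMulVec ρ ρ := rfl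
  have hdetP : (1 + (m : ℝ) • Matrix.vecMulVec ρ ρ).det = m + 1 := by
    rw [← Matrix.smul_vecMulVec, Matrix.det_add_vecMulVec_real, Matrix.det_one,
      Matrix.adjugate_one, Matrix.one_mulVec, dotProduct_smul, hρρ, smul_eq_mul, mul_one, add_comm]
  have hL : (H.comap ψ).lapMatrix ℝ = (H.lapMatrix ℝ).submatrix ψ ψ := by
    ext e f
    rw [Matrix.submatrix_apply, lapMatrix_apply_eq_sum, lapMatrix_apply_eq_sum,
      ← Equiv.sum_comp ψ]
    simp [SimpleGraph.adjMatrix_apply]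
  have hS : (2 : ℝ) • 1 + (H.comap ψ).lapMatrix ℝ -
      -Bᵀ * (1 - ((m : ℝ) / (m + 1)) • Matrix.vecMulVec ρ ρ) * -B =
      (H.lapMatrix ℝ + 1 + (-1 / (m + 1) : ℝ) • Matrix.vecMulVec 1 1).submatrix ψ ψ := by
    have h1 : (m : ℝ) / (m + 1) = 1 + (-1 / (m + 1)) := by field_simp; ring
    have h2 : Bᵀ * (1 - ((m : ℝ) / (m + 1)) • Matrix.vecMulVec ρ ρ) * B =
        1 + Matrix.vecMulVec 1 1 - ((m : ℝ) / (m + 1)) • Matrix.vecMulVec 1 1 := by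
      rw [Matrix.mul_sub, Matrix.sub_mul, Matrix.mul_one, hBB, Matrix.mul_smul, Matrix.smul_mul,
        Matrix.mul_vecMulVec, Matrix.vecMulVec_mul, hBρ, hBρ']
    have h3 : (H.lapMatrix ℝ + 1 + (-1 / (m + 1) : ℝ) • Matrix.vecMulVec 1 1).submatrix ψ ψ =
        (H.lapMatrix ℝ).submatrix ψ ψ + 1 + (-1 / (m + 1) : ℝ) • Matrix.vecMulVec 1 1 := by
      ext e f
      simp [Matrix.one_apply]
    rw [h3, Matrix.neg_mul, Matrix.neg_mul, Matrix.mul_neg, neg_neg, h2, hL, h1]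
    module
  have hev : ∀ i, (H.lapMatrix ℝ + 1) *ᵥ (x i).ofLp = (μ i + 1) • (x i).ofLp := fun i => by
    rw [Matrix.add_mulVec, hx, Matrix.one_mulVec, add_smul, one_smul]
  have hev1 : (H.lapMatrix ℝ + 1) *ᵥ 1 = (μ 0 + 1) • 1 := by
    rw [Matrix.add_mulVec, Matrix.one_mulVec, h0]
    erw [H.lapMatrix_mulVec_const_eq_zero]
    simp
  rw [hsum, lapMatrix_mergedSubdivision, hu, Matrix.fromBlocks_add, add_zero, add_zero, add_zero,
    hP, Matrix.det_fromBlocks₁₁, hinv, hdetP, hS, Matrix.det_submatrix_equiv_self,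
    Matrix.det_add_smul_ones hm x hev hev1, h0, one_pow, one_mul] at htree
  rw [← htree]
  field_simp
  ring

end Star

/-! ### The four formulas -/

theorem mainTheorem10 :
    (∀ {V : Type*} [Fintype V] [DecidableEq V] (G H : SimpleGraph V)
        [DecidableRel G.Adj] [DecidableRel H.Adj] (n m r : ℕ) [NeZero n],
        Fintype.card V = n → Nat.card G.edgeSet = m → G.IsRegularOfDegree r →
        CommutingGraphs G H →
        (∃ μG μH : Fin n → ℝ, IsJointLaplacianSpectrum G H μG μH) ∧
        ∀ μG μH : Fin n → ℝ, IsJointLaplacianSpectrum G H μG μH →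
          (numSpanningTrees (mergedSubdivision G H ⊥) : ℝ) =
            (2 : ℝ) ^ ((m : ℤ) - (n : ℤ) + 1) * (1 / (n : ℝ)) *
              ∏ i ∈ Finset.univ.erase (0 : Fin n), (2 * μH i + μG i) ∧
          (numSpanningTrees (mergedSubdivision G H ⊤) : ℝ) =
            ((m : ℝ) + 2) ^ ((m : ℤ) - (n : ℤ)) * (2 / (n : ℝ)) *
              ∏ i ∈ Finset.univ.erase (0 : Fin n),
                (((m : ℝ) + 2) * ((r : ℝ) + μH i) + μG i - 2 * (r : ℝ)) ∧
          (numSpanningTrees (mergedSubdivision G H G.lineGraphᶜ) : ℝ) =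
            ((m : ℝ) - 2 * (r : ℝ) + 2) ^ ((m : ℤ) - (n : ℤ)) * (2 / (n : ℝ)) *
              ∏ i ∈ Finset.univ.erase (0 : Fin n),
                (((r : ℝ) + μH i) * ((m : ℝ) - μG i + 2) + μG i - 2 * (r : ℝ))) ∧
    (∀ {W : Type*} [Fintype W] [DecidableEq W] (H : SimpleGraph W) [DecidableRel H.Adj]
        (m : ℕ) [NeZero m], Fintype.card W = m →
        (∃ μ : Fin m → ℝ, IsLaplacianSpectrum H μ) ∧
        ∀ (ψ : (completeBipartiteGraph (Fin 1) (Fin m)).edgeSet ≃ W) (μ : Fin m → ℝ),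
          IsLaplacianSpectrum H μ →
          (numSpanningTrees
              (mergedSubdivision (completeBipartiteGraph (Fin 1) (Fin m)) ⊥ (H.comap ψ)) : ℝ) =
            ∏ i ∈ Finset.univ.erase (0 : Fin m), (μ i + 1)) := by
  classical
  refine ⟨?_, fun H _ m _ hm => ⟨exists_isLaplacianSpectrum H hm, fun ψ μ hμ =>
    numSpanningTrees_mergedSubdivision_star H hm ψ hμ⟩⟩
  intro V _ _ G H _ _ n m r _ hn hm hr hGH
  refine ⟨exists_isJointLaplacianSpectrum hn (SimpleGraph.commute_lapMatrix hr hGH),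
    fun μG μH hμ => ?_⟩
  rw [Nat.card_eq_fintype_card] at hm
  have : Nonempty V := Fintype.card_pos_iff.1 (hn ▸ NeZero.pos n)
  have hrn : (n : ℝ) * r = 2 * m := by
    exact_mod_cast hn ▸ hm ▸ hr.card_mul_eq
  have hlt : (2 * r : ℝ) < m + 2 := by
    exact_mod_cast hm ▸ hr.two_mul_lt_card_edgeSet_add_two
  refine ⟨?_, ?_, ?_⟩
  · rw [numSpanningTrees_mergedSubdivision_of_regular hn hm hr hμ ⊥ (a := 0) (b := 0) (c := 2)
      two_ne_zero (by simp [SimpleGraph.lapMatrix, SimpleGraph.degMatrix]) (by ring),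
      zpow_add_one₀ two_ne_zero]
    rw [Finset.prod_congr rfl fun i _ =>
      show (2 + 0 * (2 * r - μG i)) * (r + μH i) - (2 * r - μG i) = 2 * μH i + μG i by ring]
    ring
  -- Here `K = -J/4`, as `BᵀJB = 4J`; the condition on the constants reduces to `nr = 2m`.
  · rw [numSpanningTrees_mergedSubdivision_of_regular hn hm hr hμ ⊤ (a := 0) (b := 1 / 4)
      (c := m + 2) (by positivity) ?_ (by linear_combination (-1 / 2 : ℝ) * hrn)]
    · congr 1
      exact Finset.prod_congr rfl fun i _ => by ring
    · rw [two_smul_one_add_lapMatrix_top, hm, zero_smul, zero_sub, Matrix.mul_neg, Matrix.neg_mul,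
        Matrix.mul_smul, Matrix.smul_mul, edgeIncMatrix_gram_ones, smul_smul, ← sub_eq_add_neg]
      norm_num
  -- Here `K = I - J/4`, the extra `I` accounting for the term `BᵀB`; `hlt` makes `c` positive.
  · rw [numSpanningTrees_mergedSubdivision_of_regular hn hm hr hμ G.lineGraphᶜ (a := 1)
      (b := 1 / 4) (c := m - 2 * r + 2) (by linarith) ?_
      (by linear_combination (-1 / 2 : ℝ) * hrn)]
    · congr 1
      exact Finset.prod_congr rfl fun i _ => by ring
    · rw [two_smul_one_add_lapMatrix_compl_lineGraph hr, hm, one_smul, Matrix.mul_sub,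
        Matrix.mul_one, Matrix.sub_mul, Matrix.mul_smul, Matrix.smul_mul,
        edgeIncMatrix_gram_ones, smul_smul]
      norm_num
      abel
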